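/- Fix an integer $n\ge 2$. A probability distribution on $\mathbb R$ is \emph{super-Pareto} if it is the distribution of $f(Y)$ for some non-decreasing, convex, non-constant function $f:[1,\infty)\to\mathbb R$, where $\mathbb P(Y\le y)=1-1/y$ for $y\ge 1$. For random variables write $X\le_{\rm st}Y$ if $\mathbb P(X\le x)\ge\mathbb P(Y\le x)$ for all $x\in\mathbb R$. A \emph{copula} is (the restriction to $[0,1]^n$ of) the joint distribution function of $n$ random variables that are each uniform on $[0,1]$; $C$ is a copula of $(X_1,\dots,X_n)$ if $\mathbb P(X_1\le x_1,\dots,X_n\le x_n)=C(\mathbb P(X_1\le x_1),\dots,\mathbb P(X_n\le x_n))$ for all $x\in\mathbb R^n$. Random variables $X_1,\dots,X_n$ are \emph{weakly negatively associated} if, for every $i$, every Borel set $S\subseteq\mathbb R^{n-1}$ that is decreasing (i.e. $\mathbf x\in S$ and $\mathbf y\le\mathbf x$ componentwise imply $\mathbf y\in S$) and every $x\in\mathbb R$ with $\mathbb P(X_i\le x)>0$, one has $\mathbb P(\mathbf X_{-i}\in S\mid X_i\le x)\le\mathbb P(\mathbf X_{-i}\in S)$, where $\mathbf X_{-i}=(X_j)_{j\ne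 i}$. Let $\mathcal C_{\rm DP}$ be the set of all copulas $C$ such that, for all identically distributed super-Pareto random variables $X_1,\dots,X_n$ for which $C$ is a copula of $(X_1,\dots,X_n)$, $$X_1\le_{\rm st}\sum_{i=1}^n\theta_iX_i\qquad\text{for all }\theta_1,\dots,\theta_n\ge 0\text{ with }\sum_{i=1}^n\theta_i=1.$$ Then $\mathcal C_{\rm DP}$ is closed under mixtures: if $C,D\in\mathcal C_{\rm DP}$ and $a\in[0,1]$, then $aC+(1-a)D\in\mathcal C_{\rm DP}$; more generally, if $\pi$ is a probability measure on a measurable space $T$ and $(C_t)_{t\in T}$ is a family in $\mathcal C_{\rm DP}$ such that $t\mapsto C_t(\mathbf u)$ is measurable for every $\mathbf u\in[0,1]^n$, then $\mathbf u\mapsto\int_T C_t(\mathbf u)\,\pi(dt)$ belongs to $\mathcal C_{\rm DP}$. Moreover, $\mathcal C_{\rm DP}$ contains the comonotonicity copula $\mathbf u\mapsto\min(u_1,\dots,u_n)$, the independence copula $\mathbf u\mapsto\prod_{i=1}^nu_i$, and the copula of any weakly negatively associated random variables $U_1,\dots,U_n$ that are each uniform on $[0,1]$. -/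

import Mathlib

open MeasureTheory ProbabilityTheory

universe u v

/-- A law `ν` on `ℝ` is super-Pareto if it is the law of `f(Y)`, where `Y ∼ Pareto(1)` (supported
on `[1, ∞)`) and `f` is increasing (in the non-strict sense), convex and non-constant there. -/
def IsSuperPareto (ν : Measure ℝ) : Prop :=
  ∃ f : ℝ → ℝ, MonotoneOn f (Set.Ici 1) ∧ ConvexOn ℝ (Set.Ici 1) f ∧
    (∃ x ∈ Set.Ici (1 : ℝ), ∃ y ∈ Set.Ici (1 : ℝ), f x ≠ f y) ∧
    ν = (paretoMeasure 1 1).map f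

/-- First-order stochastic dominance `X ≤_st Y`: `P(X ≤ x) ≥ P(Y ≤ x)` for all real `x`. -/
def StochLE {Ω : Type*} [MeasurableSpace Ω] (P : Measure Ω) (X Y : Ω → ℝ) : Prop :=
  ∀ x : ℝ, P {ω | Y ω ≤ x} ≤ P {ω | X ω ≤ x}

/-- The diversification penalty for identically distributed `X₁, …, Xₙ`: each `X j` (equivalently,
any `X` with the common law) satisfies `X j ≤_st ∑ θᵢ Xᵢ` for all `θ` in the standard simplex. -/
def DiversificationPenalty {n : ℕ} {Ω : Type*} [MeasurableSpace Ω] (P : Measure Ω)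
    (X : Fin n → Ω → ℝ) : Prop :=
  ∀ θ ∈ stdSimplex ℝ (Fin n), ∀ j : Fin n, StochLE P (X j) (fun ω => ∑ i, θ i * X i ω)

/-- Weak negative association of random variables `X₁, …, Xₙ`. Decreasing sets are lower sets for
the componentwise order; they are taken to be Borel so that the probabilities make sense. -/
def WeaklyNegAssoc {n : ℕ} {Ω : Type*} [MeasurableSpace Ω] (P : Measure Ω)
    (X : Fin n → Ω → ℝ) : Prop :=
  ∀ (i : Fin n) (S : Set ({j : Fin n // j ≠ i} → ℝ)), IsLowerSet S → MeasurableSet S →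
    ∀ x : ℝ, 0 < P {ω | X i ω ≤ x} →
      cond P {ω | X i ω ≤ x} {ω | (fun j : {j : Fin n // j ≠ i} => X j ω) ∈ S} ≤
        P {ω | (fun j : {j : Fin n // j ≠ i} => X j ω) ∈ S}

/-- A law on `ℝⁿ` all of whose one-dimensional marginals are uniform on `[0, 1]`. -/
def HasUniformMarginals {n : ℕ} (μ : Measure (Fin n → ℝ)) : Prop :=
  ∀ i, μ.map (fun x => x i) = volume.restrict (Set.Icc 0 1)

/-- The joint distribution function of a law on `ℝⁿ`, restricted to `[0, 1]ⁿ`. -/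
noncomputable def cubeCDF {n : ℕ} (μ : Measure (Fin n → ℝ)) : (Fin n → unitInterval) → ℝ :=
  fun u => μ.real {x | ∀ i, x i ≤ (u i : ℝ)}

/-- A copula, as a function on `[0, 1]ⁿ`: the distribution function of a probability law with
standard uniform marginals. -/
def IsCopula {n : ℕ} (C : (Fin n → unitInterval) → ℝ) : Prop :=
  ∃ μ : Measure (Fin n → ℝ), IsProbabilityMeasure μ ∧ HasUniformMarginals μ ∧ C = cubeCDF μ

/-- `C` is a copula of the random vector `(X₁, …, Xₙ)`:
`P(X₁ ≤ x₁, …, Xₙ ≤ xₙ) = C(F₁(x₁), …, Fₙ(xₙ))` for all `x ∈ ℝⁿ`. -/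
def IsCopulaOf {n : ℕ} {Ω : Type*} [MeasurableSpace Ω] (C : (Fin n → unitInterval) → ℝ)
    (P : Measure Ω) (X : Fin n → Ω → ℝ) : Prop :=
  IsCopula C ∧ ∀ x : Fin n → ℝ, P.real {ω | ∀ i, X i ω ≤ x i} =
    C (fun i => ⟨cdf (P.map (X i)) (x i), cdf_nonneg _ _, cdf_le_one _ _⟩)

/-- The comonotonicity copula `u ↦ min(u₁, …, uₙ)`. -/
noncomputable def comonotonicityCopula (n : ℕ) : (Fin n → unitInterval) → ℝ :=
  fun u => ⨅ i, (u i : ℝ)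

/-- The independence copula `u ↦ u₁ ⋯ uₙ`. -/
def independenceCopula (n : ℕ) : (Fin n → unitInterval) → ℝ :=
  fun u => ∏ i, (u i : ℝ)

/-- A copula for weak negative association: the copula of some weakly negatively associated standard
uniform random variables (realized as the coordinates under their joint law `μ`). -/
def IsWNACopula {n : ℕ} (C : (Fin n → unitInterval) → ℝ) : Prop :=
  ∃ μ : Measure (Fin n → ℝ), IsProbabilityMeasure μ ∧ HasUniformMarginals μ ∧
    WeaklyNegAssoc μ (fun i x => x i) ∧ C = cubeCDF μ

/-- The set of `n`-dimensional copulas `C` such that the diversification penalty holds for all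
identically distributed super-Pareto random variables `X₁, …, Xₙ` with copula `C`. -/
def copulasDP (n : ℕ) : Set ((Fin n → unitInterval) → ℝ) :=
  {C | IsCopula C ∧ ∀ (Ω : Type u) [MeasurableSpace Ω] (P : Measure Ω) [IsProbabilityMeasure P]
    (X : Fin n → Ω → ℝ), (∀ i, Measurable (X i)) → (∀ i, IsSuperPareto (P.map (X i))) →
    (∀ i j, P.map (X i) = P.map (X j)) → IsCopulaOf C P X → DiversificationPenalty P X}

/-! Write a super-Pareto vector with copula `cubeCDF μ` in law as `f(Y₁), …, f(Yₙ)`, where the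
Pareto(1) variables `Yᵢ = 1/(1 - Uᵢ)` come from `U ∼ μ`. Jensen gives `∑ θᵢ f(Yᵢ) ≥ f(∑ θᵢ Yᵢ)`, and
a monotone `f` preserves stochastic order, so the penalty for Pareto(1) marginals implies it for all
super-Pareto marginals. Membership in `copulasDP` is thus equivalent to `ParetoPenalty μ`
(`cubeCDF_mem_copulasDP_iff`).

That condition bounds `μ` of fixed events by constants not depending on `μ`. It is linear in `μ`,
hence stable under mixtures.

For the examples: under comonotonicity the weighted sum is `Y` itself. Independence and weak
negative association both put the joint distribution function below `∏ uᵢ`. This suffices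
(`ParetoPenalty.of_cubeCDF_le_prod`): `∑ θᵢ Yᵢ ≤ x` bounds each `Uᵢ` separately, and the product of
the bounds is at most `1 - 1/x`. -/

/-! ### Uniform and Pareto(1) laws. -/

/-- The uniform law on `[0, 1]`. -/
noncomputable def uniformUnit : Measure ℝ := volume.restrict (Set.Icc 0 1)

instance uniformUnit.instIsProbabilityMeasure : IsProbabilityMeasure uniformUnit :=
  ⟨by simp [uniformUnit]⟩

theorem HasUniformMarginals.map_eq {n : ℕ} {μ : Measure (Fin n → ℝ)} (h : HasUniformMarginals μ)
    (i : Fin n) : μ.map (fun x => x i) = uniformUnit := h i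

theorem uniformUnit_Iic {p : ℝ} (h1 : p ≤ 1) :
    uniformUnit (Set.Iic p) = ENNReal.ofReal p := by
  rw [uniformUnit, Measure.restrict_apply measurableSet_Iic]
  have : Set.Iic p ∩ Set.Icc (0 : ℝ) 1 = Set.Icc 0 p := by
    ext y; simp only [Set.mem_inter_iff, Set.mem_Iic, Set.mem_Icc]
    constructor
    · rintro ⟨h, h', -⟩; exact ⟨h', h⟩
    · rintro ⟨h, h'⟩; exact ⟨h', h, h'.trans h1⟩
  rw [this, Real.volume_Icc, sub_zero]

theorem ae_uniformUnit_mem_Ioo : ∀ᵐ x ∂uniformUnit, x ∈ Set.Ioo (0 : ℝ) 1 := by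
  rw [uniformUnit, restrict_Ioo_eq_restrict_Icc.symm]
  exact ae_restrict_mem measurableSet_Ioo

/-- The quantile transform of the Pareto(1) law. -/
noncomputable def toPareto (x : ℝ) : ℝ := (1 - x)⁻¹

theorem measurable_toPareto : Measurable toPareto := by
  unfold toPareto; fun_prop

theorem one_lt_toPareto {x : ℝ} (hx : x ∈ Set.Ioo (0 : ℝ) 1) : 1 < toPareto x :=
  (one_lt_inv₀ (by linarith [hx.2])).2 (by linarith [hx.1])

theorem toPareto_monotoneOn : MonotoneOn toPareto (Set.Ioo 0 1) := fun a _ b hb hab =>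
  inv_anti₀ (by linarith [hb.2]) (by linarith)

theorem paretoMeasure_Iic {x : ℝ} (hx : 1 ≤ x) :
    paretoMeasure 1 1 (Set.Iic x) = ENNReal.ofReal (1 - 1 / x) := by
  have : IsProbabilityMeasure (paretoMeasure 1 1) :=
    isProbabilityMeasure_paretoMeasure one_pos one_pos
  have hx0 : 0 < x := by linarith
  have h : paretoMeasure 1 1 (Set.Ioi x) = ENNReal.ofReal (1 / x) := by
    rw [paretoMeasure, withDensity_apply _ measurableSet_Ioi]
    have h1 : ∫⁻ y in Set.Ioi x, paretoPDF 1 1 y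
        = ∫⁻ y in Set.Ioi x, ENNReal.ofReal (y ^ (-2 : ℝ)) := by
      refine setLIntegral_congr_fun measurableSet_Ioi fun y (hy : x < y) => ?_
      simp only [paretoPDF_of_le (hx.trans hy.le)]
      norm_num
    rw [h1, ← ofReal_integral_eq_lintegral_ofReal
      (integrableOn_Ioi_rpow_of_lt (by norm_num) hx0), integral_Ioi_rpow_of_lt (by norm_num) hx0]
    · congr 1
      norm_num [Real.rpow_neg_one]
    · refine (ae_restrict_iff' measurableSet_Ioi).2 (ae_of_all _ fun y (hy : x < y) => ?_)
      have : 0 < y := hx0.trans hy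
      simp only [Pi.zero_apply]; positivity
  rw [← Set.compl_Ioi, prob_compl_eq_one_sub measurableSet_Ioi, h, ← ENNReal.ofReal_one,
    ENNReal.ofReal_sub _ (by positivity)]

theorem paretoMeasure_Iio_one : paretoMeasure 1 1 (Set.Iio 1) = 0 := by
  rw [paretoMeasure, withDensity_apply _ measurableSet_Iio]
  exact lintegral_paretoPDF_of_le le_rfl

theorem map_toPareto_uniformUnit : uniformUnit.map toPareto = paretoMeasure 1 1 := by
  have : IsProbabilityMeasure (paretoMeasure 1 1) :=
    isProbabilityMeasure_paretoMeasure one_pos one_pos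
  have : IsProbabilityMeasure (uniformUnit.map toPareto) :=
    Measure.isProbabilityMeasure_map measurable_toPareto.aemeasurable
  refine Measure.ext_of_Iic _ _ fun x => ?_
  rw [Measure.map_apply measurable_toPareto measurableSet_Iic]
  rcases lt_or_ge x 1 with hx | hx
  · rw [measure_mono_null (Set.Iic_subset_Iio.2 hx) paretoMeasure_Iio_one]
    have : ∀ᵐ y ∂uniformUnit, y ∉ toPareto ⁻¹' Set.Iic x := by
      filter_upwards [ae_uniformUnit_mem_Ioo] with y hy hyx
      exact absurd (one_lt_toPareto hy) (not_lt.2 ((Set.mem_Iic.1 hyx).trans hx.le))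
    simpa using measure_eq_zero_iff_ae_notMem.2 this
  · have hx0 : 0 < x := by linarith
    rw [paretoMeasure_Iic hx, ← uniformUnit_Iic (by linarith [one_div_pos.2 hx0])]
    refine measure_congr ?_
    filter_upwards [ae_uniformUnit_mem_Ioo] with y hy
    refine propext ?_
    change (1 - y)⁻¹ ≤ x ↔ y ≤ 1 - 1 / x
    rw [inv_le_comm₀ (by linarith [hy.2]) hx0, one_div]
    constructor <;> intro <;> linarith

theorem HasUniformMarginals.ae {n : ℕ} {μ : Measure (Fin n → ℝ)} (h : HasUniformMarginals μ)
    {p : ℝ → Prop} (hp : ∀ᵐ x ∂uniformUnit, p x) : ∀ᵐ x ∂μ, ∀ i, p (x i) := by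
  refine ae_all_iff.2 fun i => ?_
  rw [← h.map_eq i] at hp
  exact ae_of_ae_map (measurable_pi_apply i).aemeasurable hp

theorem HasUniformMarginals.ae_mem_Ioo {n : ℕ} {μ : Measure (Fin n → ℝ)}
    (h : HasUniformMarginals μ) : ∀ᵐ x ∂μ, ∀ i, x i ∈ Set.Ioo (0 : ℝ) 1 :=
  h.ae ae_uniformUnit_mem_Ioo

/-! ### The Pareto(1) penalty and negative lower orthant dependence. -/

/-- The diversification penalty for Pareto(1) random variables whose copula is the distribution
function of `μ`. -/
def ParetoPenalty {n : ℕ} (μ : Measure (Fin n → ℝ)) : Prop :=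
  ∀ θ ∈ stdSimplex ℝ (Fin n), ∀ x : ℝ,
    μ {y | ∑ i, θ i * toPareto (y i) ≤ x} ≤ paretoMeasure 1 1 (Set.Iic x)

theorem measurable_sum_mul_toPareto {n : ℕ} (θ : Fin n → ℝ) :
    Measurable fun y : Fin n → ℝ => ∑ i, θ i * toPareto (y i) :=
  Finset.measurable_fun_sum _ fun i _ =>
    (measurable_toPareto.comp (measurable_pi_apply i)).const_mul _

theorem measurableSet_sum_mul_toPareto_le {n : ℕ} (θ : Fin n → ℝ) (x : ℝ) :
    MeasurableSet {y : Fin n → ℝ | ∑ i, θ i * toPareto (y i) ≤ x} :=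
  measurableSet_le (measurable_sum_mul_toPareto θ) measurable_const

/-- Taking reciprocals, this is `∏ (1 + θᵢ/s) ≥ 1 + ∑ θᵢ/s`: expand the product and drop the
nonnegative higher-order terms. -/
theorem prod_div_add_le {ι : Type*} (A : Finset ι) (θ : ι → ℝ) (hθ : ∀ i, 0 ≤ θ i) {s : ℝ}
    (hs : 0 < s) : ∏ i ∈ A, s / (s + θ i) ≤ s / (s + ∑ i ∈ A, θ i) := by
  classical
  induction A using Finset.induction_on with
  | empty => simp [hs.ne']
  | insert a A ha ih =>
    have h1 := hθ a
    have h2 : 0 ≤ ∑ i ∈ A, θ i := Finset.sum_nonneg fun i _ => hθ i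
    rw [Finset.prod_insert ha, Finset.sum_insert ha]
    refine (mul_le_mul_of_nonneg_left ih (by positivity)).trans ?_
    rw [div_mul_div_comm, div_le_div_iff₀ (by positivity) (by positivity)]
    nlinarith [mul_nonneg h1 h2, mul_nonneg hs.le (mul_nonneg h1 h2)]

/-- Negative lower orthant dependence implies the penalty for Pareto(1) marginals. -/
theorem ParetoPenalty.of_cubeCDF_le_prod {n : ℕ} {μ : Measure (Fin n → ℝ)}
    [IsProbabilityMeasure μ] (h : HasUniformMarginals μ)
    (hle : ∀ w, cubeCDF μ w ≤ ∏ i, (w i : ℝ)) : ParetoPenalty μ := by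
  rintro θ ⟨hθ, hsum⟩ x
  rcases le_or_gt x 1 with hx | hx
  · have : μ {y | ∑ i, θ i * toPareto (y i) ≤ x} = 0 := by
      refine measure_eq_zero_iff_ae_notMem.2 ?_
      filter_upwards [h.ae_mem_Ioo] with y hy hyx
      have hyx' : ∑ i, θ i * toPareto (y i) ≤ x := hyx
      obtain ⟨i, -, hi⟩ : ∃ i ∈ Finset.univ, 0 < θ i := by
        by_contra! hcon
        linarith [Finset.sum_nonpos hcon]
      have : ∑ i, θ i < ∑ i, θ i * toPareto (y i) :=
        Finset.sum_lt_sum (fun j _ => le_mul_of_one_le_right (hθ j) (one_lt_toPareto (hy j)).le)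
          ⟨i, Finset.mem_univ i, lt_mul_of_one_lt_right hi (one_lt_toPareto (hy i))⟩
      linarith
    rw [this]; exact zero_le
  · have hs : 0 < x - 1 := by linarith
    have hw (i : Fin n) : (x - 1) / (x - 1 + θ i) ∈ Set.Icc (0 : ℝ) 1 := by
      have := hθ i
      exact ⟨by positivity, (div_le_one (by positivity)).2 (by linarith)⟩
    -- Since all `Yⱼ ≥ 1`, the single term `θᵢ (Yᵢ - 1)` is at most `x - 1`; solving with `Yᵢ = 1/(1
    -- - uᵢ)` gives `uᵢ ≤ w i`. For `θᵢ = 0` the bound is the vacuous `1`.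
    let w : Fin n → unitInterval := fun i => ⟨(x - 1) / (x - 1 + θ i), hw i⟩
    calc μ {y | ∑ i, θ i * toPareto (y i) ≤ x} ≤ μ {y | ∀ i, y i ≤ (w i : ℝ)} := by
          refine measure_mono_ae ?_
          filter_upwards [h.ae_mem_Ioo] with y hy hyx i
          have hyx' : ∑ i, θ i * toPareto (y i) ≤ x := hyx
          have h1 : θ i * (toPareto (y i) - 1) ≤ ∑ j, θ j * (toPareto (y j) - 1) :=
            Finset.single_le_sum (f := fun j => θ j * (toPareto (y j) - 1))
              (fun j _ => mul_nonneg (hθ j) (by linarith [one_lt_toPareto (hy j)]))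
              (Finset.mem_univ i)
          have h2 : ∑ j, θ j * (toPareto (y j) - 1) ≤ x - 1 := by
            simp only [mul_sub, mul_one, Finset.sum_sub_distrib, hsum]; linarith
          have h3 : 0 < 1 - y i := by linarith [(hy i).2]
          have h4 : toPareto (y i) * (1 - y i) = 1 := inv_mul_cancel₀ h3.ne'
          have h5 := mul_le_mul_of_nonneg_right (h1.trans h2) h3.le
          change y i ≤ (x - 1) / (x - 1 + θ i)
          rw [le_div_iff₀ (by linarith [hθ i])]
          have h6 : θ i * (toPareto (y i) - 1) * (1 - y i) = θ i * y i := by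
            linear_combination θ i * h4
          linarith
      _ = ENNReal.ofReal (cubeCDF μ w) := by simp [cubeCDF]
      _ ≤ ENNReal.ofReal (1 - 1 / x) := by
          refine ENNReal.ofReal_le_ofReal ((hle w).trans ?_)
          refine (prod_div_add_le _ θ hθ hs).trans (le_of_eq ?_)
          rw [hsum]; field_simp; ring
      _ = _ := (paretoMeasure_Iic hx.le).symm

/-- Peel off one coordinate at a time: the constraints on the remaining ones form a decreasing
event, so conditioning on `x a ≤ c a` cannot raise its probability. -/
theorem WeaklyNegAssoc.measure_forall_le_le_prod {n : ℕ} {μ : Measure (Fin n → ℝ)}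
    [IsProbabilityMeasure μ] (h : WeaklyNegAssoc μ (fun i x => x i)) (c : Fin n → ℝ)
    (A : Finset (Fin n)) : μ {x | ∀ i ∈ A, x i ≤ c i} ≤ ∏ i ∈ A, μ {x | x i ≤ c i} := by
  classical
  induction A using Finset.induction_on with
  | empty => simp
  | insert a A ha ih =>
    rw [Finset.prod_insert ha]
    rcases eq_or_ne (μ {x | x a ≤ c a}) 0 with h0 | h0
    · refine (measure_mono_null (fun x hx => ?_) h0).trans_le zero_le
      exact hx a (Finset.mem_insert_self a A)
    · have hm : MeasurableSet {x : Fin n → ℝ | x a ≤ c a} :=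
        measurableSet_le (measurable_pi_apply a) measurable_const
      let S : Set ({j : Fin n // j ≠ a} → ℝ) := 
        {y | ∀ j : {j : Fin n // j ≠ a}, (j : Fin n) ∈ A → y j ≤ c j}
      have hS : MeasurableSet S := by
        simp only [S, Set.ofPred_forall]
        exact MeasurableSet.iInter fun j => MeasurableSet.iInter fun _ =>
          measurableSet_le (measurable_pi_apply j) measurable_const
      have key := h a S (fun y z hzy hy j hj => (hzy j).trans (hy j hj)) hS (c a)
        (pos_iff_ne_zero.2 h0)
      have hset : {x : Fin n → ℝ | (fun j : {j : Fin n // j ≠ a} => x j) ∈ S}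
          = {x | ∀ i ∈ A, x i ≤ c i} := by
        ext x
        exact ⟨fun hx i hi => hx ⟨i, fun hia : i = a => ha (hia ▸ hi)⟩ hi, fun hx j hj => hx j hj⟩
      rw [hset] at key
      have hins : {x : Fin n → ℝ | ∀ i ∈ insert a A, x i ≤ c i}
          = {x | x a ≤ c a} ∩ {x | ∀ i ∈ A, x i ≤ c i} := by
        ext x; simp
      rw [hins, ← cond_mul_eq_inter hm, mul_comm]
      exact mul_le_mul_right (key.trans ih) _

theorem WeaklyNegAssoc.cubeCDF_le_prod {n : ℕ} {μ : Measure (Fin n → ℝ)}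
    [IsProbabilityMeasure μ] (h : WeaklyNegAssoc μ (fun i x => x i)) (hu : HasUniformMarginals μ)
    (w : Fin n → unitInterval) : cubeCDF μ w ≤ ∏ i, (w i : ℝ) := by
  have key := h.measure_forall_le_le_prod (fun i => (w i : ℝ)) Finset.univ
  have hi (i : Fin n) : μ {x | x i ≤ (w i : ℝ)} = ENNReal.ofReal (w i) := by
    rw [← uniformUnit_Iic (w i).2.2, ← hu.map_eq i,
      Measure.map_apply (measurable_pi_apply i) measurableSet_Iic]
    rfl
  simp only [hi, Finset.mem_univ, true_implies] at key
  rw [← ENNReal.ofReal_prod_of_nonneg fun i _ => (w i).2.1] at key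
  exact ENNReal.toReal_le_of_le_ofReal (Finset.prod_nonneg fun i _ => (w i).2.1) key

/-! ### Increasing transforms and joint distribution functions. -/

/-- By monotonicity `{g ≤ y}` is, inside `(0, 1)`, an initial segment whose length is the value of
the cdf. Only its endpoint is ambiguous, and that is a null set. -/
theorem ae_le_iff_le_cdf {g : ℝ → ℝ} (hg : Measurable g) (hmono : MonotoneOn g (Set.Ioo 0 1))
    (y : ℝ) : ∀ᵐ t ∂uniformUnit, (g t ≤ y ↔ t ≤ cdf (uniformUnit.map g) y) := by
  have : IsProbabilityMeasure (uniformUnit.map g) :=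
    Measure.isProbabilityMeasure_map hg.aemeasurable
  set p := cdf (uniformUnit.map g) y with hp
  have hp0 : 0 ≤ p := cdf_nonneg _ _
  have hp1 : p ≤ 1 := cdf_le_one _ _
  have hA : uniformUnit {t | g t ≤ y} = ENNReal.ofReal p := by
    rw [hp, ofReal_cdf, Measure.map_apply hg measurableSet_Iic]; rfl
  have hne : ∀ᵐ t ∂uniformUnit, t ≠ p := by
    rw [uniformUnit]
    exact ae_restrict_of_ae (Measure.ae_ne volume p)
  filter_upwards [ae_uniformUnit_mem_Ioo, hne] with t ht htp
  have hle := uniformUnit_Iic ht.2.le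
  constructor
  · intro hgt
    refine (ENNReal.ofReal_le_ofReal_iff hp0).1 ?_
    rw [← hle, ← hA]
    refine measure_mono_ae ?_
    filter_upwards [ae_uniformUnit_mem_Ioo] with s hs hst
    exact (hmono hs ht hst).trans hgt
  · intro htp'
    by_contra! hgt
    refine htp (le_antisymm htp' ((ENNReal.ofReal_le_ofReal_iff ht.1.le).1 ?_))
    rw [← hle, ← hA]
    refine measure_mono_ae ?_
    filter_upwards [ae_uniformUnit_mem_Ioo] with s hs hsy
    by_contra hts
    exact absurd ((hmono ht hs (not_le.1 hts).le).trans hsy) (not_le.2 hgt)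

/-- The joint distribution function of increasing transforms of the coordinates. -/
theorem HasUniformMarginals.measureReal_forall_le {n : ℕ} {μ : Measure (Fin n → ℝ)}
    (h : HasUniformMarginals μ) {g : ℝ → ℝ} (hg : Measurable g)
    (hmono : MonotoneOn g (Set.Ioo 0 1)) (y : Fin n → ℝ) :
    μ.real {t | ∀ i, g (t i) ≤ y i} =
      cubeCDF μ fun i => ⟨cdf (uniformUnit.map g) (y i), cdf_nonneg _ _, cdf_le_one _ _⟩ := by
  refine measureReal_congr ?_
  have hall : ∀ᵐ t ∂μ, ∀ i j, (g (t j) ≤ y i ↔ t j ≤ cdf (uniformUnit.map g) (y i)) :=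
    ae_all_iff.2 fun i => h.ae (ae_le_iff_le_cdf hg hmono (y i))
  filter_upwards [hall] with t ht
  exact propext (forall_congr' fun i => ht i i)

theorem generateFrom_pi_Iic (n : ℕ) :
    MeasurableSpace.generateFrom
      (Set.univ.pi '' Set.univ.pi fun _ : Fin n => Set.range (Set.Iic : ℝ → Set ℝ)) =
      MeasurableSpace.pi := by
  refine generateFrom_eq_pi (fun _ => ?_) fun _ => ?_
  · rw [← borel_eq_generateFrom_Iic ℝ, BorelSpace.measurable_eq (α := ℝ)]
  · refine ⟨fun k : ℕ => Set.Iic (k : ℝ), fun k => ⟨_, rfl⟩, ?_⟩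
    refine Set.eq_univ_of_forall fun x => ?_
    obtain ⟨k, hk⟩ := exists_nat_ge x
    exact Set.mem_iUnion.2 ⟨k, hk⟩

theorem isPiSystem_pi_Iic (n : ℕ) :
    IsPiSystem (Set.univ.pi '' Set.univ.pi fun _ : Fin n => Set.range (Set.Iic : ℝ → Set ℝ)) :=
  IsPiSystem.pi fun _ => isPiSystem_Iic

theorem exists_eq_of_mem_pi_Iic {n : ℕ} {s : Set (Fin n → ℝ)}
    (hs : s ∈ Set.univ.pi '' Set.univ.pi fun _ : Fin n => Set.range (Set.Iic : ℝ → Set ℝ)) :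
    ∃ y : Fin n → ℝ, s = {x | ∀ i, x i ≤ y i} := by
  obtain ⟨t, ht, rfl⟩ := hs
  choose y hy using fun i => ht i (Set.mem_univ i)
  refine ⟨y, ?_⟩
  ext x
  simp [Set.mem_pi, ← hy]

/-- Laws on `ℝⁿ` are determined by their joint distribution functions. -/
theorem measure_ext_of_forall_le {n : ℕ} {μ ν : Measure (Fin n → ℝ)} [IsProbabilityMeasure μ]
    [IsProbabilityMeasure ν]
    (h : ∀ y : Fin n → ℝ, μ {x | ∀ i, x i ≤ y i} = ν {x | ∀ i, x i ≤ y i}) : μ = ν := by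
  refine ext_of_generate_finite _ (generateFrom_pi_Iic n).symm (isPiSystem_pi_Iic n) ?_ (by simp)
  intro s hs
  obtain ⟨y, rfl⟩ := exists_eq_of_mem_pi_Iic hs
  exact h y

/-! ### Reduction of super-Pareto marginals to Pareto(1). -/

/-- A nonempty lower set bounded above is `Iio` or `Iic` of its supremum. Both have the same
`ρ`-measure, as `ρ` has no atoms, so the comparison on `Iic` covers both. -/
theorem measure_le_of_isLowerSet {σ ρ : Measure ℝ} [IsProbabilityMeasure σ]
    [IsProbabilityMeasure ρ] [NullSingletonClass ρ] (h : ∀ x, σ (Set.Iic x) ≤ ρ (Set.Iic x))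
    {B : Set ℝ} (hB : IsLowerSet B) : σ B ≤ ρ B := by
  rcases B.eq_empty_or_nonempty with rfl | hne
  · simp
  by_cases hbdd : BddAbove B
  · calc σ B ≤ σ (Set.Iic (sSup B)) := measure_mono fun x hx => le_csSup hbdd hx
      _ ≤ ρ (Set.Iic (sSup B)) := h _
      _ = ρ (Set.Iio (sSup B)) := (measure_congr Iio_ae_eq_Iic).symm
      _ ≤ ρ B := measure_mono fun x hx => by
          obtain ⟨b, hb, hxb⟩ := exists_lt_of_lt_csSup hne hx
          exact hB hxb.le hb
  · have : B = Set.univ := Set.eq_univ_of_forall fun x => by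
      obtain ⟨b, hb, hxb⟩ := not_bddAbove_iff.1 hbdd x
      exact hB hxb.le hb
    simp [this]

instance paretoMeasure.instNullSingletonClass (t r : ℝ) : NullSingletonClass (paretoMeasure t r) := by
  unfold paretoMeasure; infer_instance

theorem ae_paretoMeasure_one_le : ∀ᵐ y ∂paretoMeasure 1 1, 1 ≤ y := by
  filter_upwards [measure_eq_zero_iff_ae_notMem.1 paretoMeasure_Iio_one] with y hy
  exact not_lt.1 hy

/-- A super-Pareto law is the law of `f(Y)` for `f` monotone on the whole line. -/
theorem IsSuperPareto.exists_monotone {ν : Measure ℝ} (h : IsSuperPareto ν) :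
    ∃ f : ℝ → ℝ, Monotone f ∧ ConvexOn ℝ (Set.Ici 1) f ∧ ν = (paretoMeasure 1 1).map f := by
  obtain ⟨f, hmono, hconv, -, rfl⟩ := h
  have heq : Set.EqOn f (fun y => f (max 1 y)) (Set.Ici 1) := fun y hy => by
    change f y = f (max 1 y)
    rw [max_eq_right hy]
  -- Below `1` the given `f` is arbitrary. Freezing it at `f 1` there leaves the law unchanged and
  -- yields a globally monotone, hence measurable, function.
  refine ⟨fun y => f (max 1 y), fun a b hab => ?_, hconv.congr heq, ?_⟩
  · exact hmono (le_max_left 1 a) (le_max_left 1 b) (max_le_max le_rfl hab)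
  · refine Measure.map_congr ?_
    filter_upwards [ae_paretoMeasure_one_le] with y hy using heq hy

theorem isSuperPareto_paretoMeasure : IsSuperPareto (paretoMeasure 1 1) :=
  ⟨id, monotone_id.monotoneOn _, convexOn_id (convex_Ici 1), ⟨1, by simp, 2, by simp, by simp⟩,
    Measure.map_id.symm⟩

/-- The law of a vector of super-Pareto random variables with copula `cubeCDF μ`. -/
theorem HasUniformMarginals.map_eq_of_isCopulaOf {n : ℕ} {μ : Measure (Fin n → ℝ)}
    [IsProbabilityMeasure μ] (hμ : HasUniformMarginals μ) {Ω : Type*} [MeasurableSpace Ω]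
    {P : Measure Ω} [IsProbabilityMeasure P] {X : Fin n → Ω → ℝ} (hX : ∀ i, Measurable (X i))
    {g : ℝ → ℝ} (hg : Measurable g) (hmono : MonotoneOn g (Set.Ioo 0 1))
    (hlaw : ∀ i, P.map (X i) = uniformUnit.map g) (hC : IsCopulaOf (cubeCDF μ) P X) :
    P.map (fun ω i => X i ω) = μ.map (fun t i => g (t i)) := by
  have hm1 : Measurable fun ω i => X i ω := measurable_pi_lambda _ hX
  have hm2 : Measurable fun (t : Fin n → ℝ) i => g (t i) :=
    measurable_pi_lambda _ fun i => hg.comp (measurable_pi_apply i)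
  have := Measure.isProbabilityMeasure_map (μ := P) hm1.aemeasurable
  have := Measure.isProbabilityMeasure_map (μ := μ) hm2.aemeasurable
  refine measure_ext_of_forall_le fun y => ?_
  have hs : MeasurableSet {x : Fin n → ℝ | ∀ i, x i ≤ y i} := by
    simp only [Set.ofPred_forall]
    exact MeasurableSet.iInter fun i => measurableSet_le (measurable_pi_apply i) measurable_const
  rw [Measure.map_apply hm1 hs, Measure.map_apply hm2 hs]
  refine (measureReal_eq_measureReal_iff).1 ?_
  refine (hC.2 y).trans ?_
  simp only [hlaw]
  exact (hμ.measureReal_forall_le hg hmono y).symm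

theorem ParetoPenalty.diversificationPenalty {n : ℕ} {μ : Measure (Fin n → ℝ)}
    [IsProbabilityMeasure μ] (hμ : HasUniformMarginals μ) (hpen : ParetoPenalty μ) {Ω : Type*}
    [MeasurableSpace Ω] {P : Measure Ω} [IsProbabilityMeasure P] {X : Fin n → Ω → ℝ}
    (hX : ∀ i, Measurable (X i)) (hsp : ∀ i, IsSuperPareto (P.map (X i)))
    (hid : ∀ i j, P.map (X i) = P.map (X j)) (hC : IsCopulaOf (cubeCDF μ) P X) :
    DiversificationPenalty P X := by
  intro θ hθ j x
  obtain ⟨f, hf, hconv, hlaw⟩ := (hsp j).exists_monotone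
  have : IsProbabilityMeasure (paretoMeasure 1 1) :=
    isProbabilityMeasure_paretoMeasure one_pos one_pos
  have hfm : Measurable f := hf.measurable
  have hgm : Measurable (f ∘ toPareto) := hfm.comp measurable_toPareto
  have hlaw' (i : Fin n) : P.map (X i) = uniformUnit.map (f ∘ toPareto) := by
    rw [hid i j, hlaw, ← map_toPareto_uniformUnit, Measure.map_map hfm measurable_toPareto]
  have hvec := hμ.map_eq_of_isCopulaOf hX hgm (hf.comp_monotoneOn toPareto_monotoneOn) hlaw' hC
  have hs : MeasurableSet {z : Fin n → ℝ | ∑ i, θ i * z i ≤ x} :=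
    measurableSet_le (Finset.measurable_fun_sum _ fun i _ =>
      (measurable_pi_apply i).const_mul _) measurable_const
  have hm2 : Measurable fun (t : Fin n → ℝ) i => (f ∘ toPareto) (t i) :=
    measurable_pi_lambda _ fun i => hgm.comp (measurable_pi_apply i)
  have hsum := measurable_sum_mul_toPareto θ
  have hlow : IsLowerSet {y | f y ≤ x} := fun a b hba ha => (hf hba).trans ha
  have hlm : MeasurableSet {y | f y ≤ x} := measurableSet_le hfm measurable_const
  have := Measure.isProbabilityMeasure_map (μ := μ) hsum.aemeasurable
  calc P {ω | ∑ i, θ i * X i ω ≤ x}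
      = P.map (fun ω i => X i ω) {z | ∑ i, θ i * z i ≤ x} :=
        (Measure.map_apply (measurable_pi_lambda _ hX) hs).symm
    _ = μ {t | ∑ i, θ i * f (toPareto (t i)) ≤ x} := by
        rw [hvec, Measure.map_apply hm2 hs]; rfl
    _ ≤ μ {t | f (∑ i, θ i * toPareto (t i)) ≤ x} := by
        refine measure_mono_ae ?_
        filter_upwards [hμ.ae_mem_Ioo] with t ht htx
        exact (hconv.map_sum_le (fun i _ => hθ.1 i) hθ.2
          fun i _ => (one_lt_toPareto (ht i)).le).trans htx
    _ = μ.map (fun t => ∑ i, θ i * toPareto (t i)) {y | f y ≤ x} :=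
        (Measure.map_apply hsum hlm).symm
    _ ≤ paretoMeasure 1 1 {y | f y ≤ x} := by
        refine measure_le_of_isLowerSet (fun y => ?_) hlow
        rw [Measure.map_apply hsum measurableSet_Iic]
        exact hpen θ hθ y
    _ = P.map (X j) (Set.Iic x) := by
        rw [hlaw, Measure.map_apply hfm measurableSet_Iic]; rfl
    _ = P {ω | X j ω ≤ x} := Measure.map_apply (hX j) measurableSet_Iic

/-- Test the definition on the Pareto(1) vector `toPareto (y i)` under `μ`; `ULift` only moves the
sample space into the universe over which `copulasDP` quantifies. -/
theorem ParetoPenalty.of_mem_copulasDP {n : ℕ} (hn : 0 < n) {μ : Measure (Fin n → ℝ)}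
    [IsProbabilityMeasure μ] (hμ : HasUniformMarginals μ)
    (h : cubeCDF μ ∈ copulasDP.{u} n) : ParetoPenalty μ := by
  intro θ hθ x
  have hup : Measurable (ULift.up.{u} : (Fin n → ℝ) → ULift (Fin n → ℝ)) := measurable_up
  have hdown : Measurable (ULift.down.{u} : ULift (Fin n → ℝ) → (Fin n → ℝ)) := measurable_down
  let P : Measure (ULift.{u} (Fin n → ℝ)) := μ.map ULift.up
  have : IsProbabilityMeasure P := Measure.isProbabilityMeasure_map hup.aemeasurable
  let X : Fin n → ULift.{u} (Fin n → ℝ) → ℝ := fun i ω => toPareto (ω.down i)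
  have hX (i : Fin n) : Measurable (X i) :=
    measurable_toPareto.comp ((measurable_pi_apply i).comp hdown)
  have hP (s : Set (ULift.{u} (Fin n → ℝ))) (hs : MeasurableSet s) : P s = μ (ULift.up ⁻¹' s) :=
    Measure.map_apply hup hs
  have hlaw (i : Fin n) : P.map (X i) = paretoMeasure 1 1 := by
    rw [Measure.map_map (hX i) hup, ← map_toPareto_uniformUnit, ← hμ.map_eq i,
      Measure.map_map measurable_toPareto (measurable_pi_apply i)]
    rfl
  have hC : IsCopulaOf (cubeCDF μ) P X := by
    refine ⟨h.1, fun y => ?_⟩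
    have hs : MeasurableSet {ω | ∀ i, X i ω ≤ y i} := by
      simp only [Set.ofPred_forall]
      exact MeasurableSet.iInter fun i => measurableSet_le (hX i) measurable_const
    rw [measureReal_def, hP _ hs]
    simp only [hlaw, ← map_toPareto_uniformUnit]
    exact hμ.measureReal_forall_le measurable_toPareto toPareto_monotoneOn y
  have key := h.2 _ P X hX (fun i => (hlaw i).symm ▸ isSuperPareto_paretoMeasure)
    (fun i j => (hlaw i).trans (hlaw j).symm) hC θ hθ ⟨0, hn⟩ x
  have hs : MeasurableSet {ω | ∑ i, θ i * X i ω ≤ x} :=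
    measurableSet_le (Finset.measurable_fun_sum _ fun i _ => (hX i).const_mul _) measurable_const
  rw [hP _ hs] at key
  refine key.trans (le_of_eq ?_)
  rw [← hlaw ⟨0, hn⟩, Measure.map_apply (hX _) measurableSet_Iic]
  rfl

/-- Membership in `copulasDP` only has to be checked for Pareto(1) marginals. -/
theorem cubeCDF_mem_copulasDP_iff {n : ℕ} (hn : 0 < n) {μ : Measure (Fin n → ℝ)}
    [IsProbabilityMeasure μ] (hμ : HasUniformMarginals μ) :
    cubeCDF μ ∈ copulasDP.{u} n ↔ ParetoPenalty μ :=
  ⟨ParetoPenalty.of_mem_copulasDP hn hμ, fun hpen =>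
    ⟨⟨μ, inferInstance, hμ, rfl⟩, fun _ _ _ _ _ hX hsp hid hC =>
      hpen.diversificationPenalty hμ hX hsp hid hC⟩⟩

theorem exists_paretoPenalty_of_mem_copulasDP {n : ℕ} (hn : 0 < n)
    {C : (Fin n → unitInterval) → ℝ} (hC : C ∈ copulasDP.{u} n) :
    ∃ μ : Measure (Fin n → ℝ), IsProbabilityMeasure μ ∧ HasUniformMarginals μ ∧
      ParetoPenalty μ ∧ C = cubeCDF μ := by
  obtain ⟨μ, hprob, hμ, rfl⟩ := hC.1
  exact ⟨μ, hprob, hμ, ParetoPenalty.of_mem_copulasDP hn hμ hC, rfl⟩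

/-! ### Closure under mixtures. -/

/-- Almost surely all coordinates lie in `(0, 1)`, so thresholds may be clamped to `[0, 1]`; the
copula therefore gives the measure of every lower orthant. -/
theorem HasUniformMarginals.measureReal_forall_le_eq_cubeCDF {n : ℕ} {μ : Measure (Fin n → ℝ)}
    (h : HasUniformMarginals μ) (y : Fin n → ℝ) :
    μ.real {x | ∀ i, x i ≤ y i} =
      cubeCDF μ fun i => Set.projIcc 0 1 zero_le_one (y i) := by
  refine measureReal_congr ?_
  filter_upwards [h.ae_mem_Ioo] with x hx
  refine propext (forall_congr' fun i => ?_)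
  have := hx i
  simp only [Set.coe_projIcc, le_max_iff, le_min_iff, not_le.2 this.1, this.2.le, true_and,
    false_or]

/-- `copulasDP` is closed under arbitrary mixtures. -/
theorem integral_mem_copulasDP {n : ℕ} (hn : 0 < n) {T : Type*} [MeasurableSpace T]
    (π : Measure T) [IsProbabilityMeasure π] {C : T → (Fin n → unitInterval) → ℝ}
    (hC : ∀ t, C t ∈ copulasDP.{u} n) (hm : ∀ w, Measurable fun t => C t w) :
    (fun w => ∫ t, C t w ∂π) ∈ copulasDP.{u} n := by
  choose μ hprob hμ hpen hCμ using fun t => exists_paretoPenalty_of_mem_copulasDP hn (hC t)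
  -- The laws `μ t` are picked by choice, but the copulas fix their values on the π-system of lower
  -- orthants, and those values are measurable in `t`.
  have hmeas : Measurable μ := by
    refine Measurable.measure_of_isPiSystem_of_isProbabilityMeasure (generateFrom_pi_Iic n).symm
      (isPiSystem_pi_Iic n) fun s hs => ?_
    obtain ⟨y, rfl⟩ := exists_eq_of_mem_pi_Iic hs
    have : (fun t => μ t {x | ∀ i, x i ≤ y i}) =
        fun t => ENNReal.ofReal (C t fun i => Set.projIcc 0 1 zero_le_one (y i)) := by
      ext t
      rw [hCμ t, ← (hμ t).measureReal_forall_le_eq_cubeCDF, ofReal_measureReal]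
    rw [this]
    exact (hm _).ennreal_ofReal
  have hmix (s : Set (Fin n → ℝ)) (hs : MeasurableSet s) : π.bind μ s = ∫⁻ t, μ t s ∂π :=
    Measure.bind_apply hs hmeas.aemeasurable
  have hprobmix : IsProbabilityMeasure (π.bind μ) := ⟨by simp [hmix _ MeasurableSet.univ]⟩
  have humix : HasUniformMarginals (π.bind μ) := by
    intro i
    ext s hs
    rw [Measure.map_apply (measurable_pi_apply i) hs, hmix _ (measurable_pi_apply i hs)]
    have (t : T) : μ t ((fun x => x i) ⁻¹' s) = volume.restrict (Set.Icc 0 1) s := by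
      rw [← hμ t i, Measure.map_apply (measurable_pi_apply i) hs]
    simp [this]
  have hcdf : (fun w => ∫ t, C t w ∂π) = cubeCDF (π.bind μ) := by
    ext w
    have hs : MeasurableSet {x : Fin n → ℝ | ∀ i, x i ≤ (w i : ℝ)} := by
      simp only [Set.ofPred_forall]
      exact MeasurableSet.iInter fun i =>
        measurableSet_le (measurable_pi_apply i) measurable_const
    rw [cubeCDF, measureReal_def, hmix _ hs, ← integral_toReal]
    · simp only [hCμ]; rfl
    · exact (Measure.measurable_coe hs |>.comp hmeas).aemeasurable
    · exact ae_of_all _ fun t => measure_lt_top _ _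
  rw [hcdf, cubeCDF_mem_copulasDP_iff hn humix]
  intro θ hθ x
  rw [hmix _ (measurableSet_sum_mul_toPareto_le θ x)]
  calc ∫⁻ t, μ t {y | ∑ i, θ i * toPareto (y i) ≤ x} ∂π
      ≤ ∫⁻ _, paretoMeasure 1 1 (Set.Iic x) ∂π := lintegral_mono fun t => hpen t θ hθ x
    _ = _ := by simp

/-- `copulasDP` is closed under mixtures of two copulas. -/
theorem mix_mem_copulasDP {n : ℕ} (hn : 0 < n) {C D : (Fin n → unitInterval) → ℝ}
    (hC : C ∈ copulasDP.{u} n) (hD : D ∈ copulasDP.{u} n) {a : ℝ} (ha : a ∈ Set.Icc (0 : ℝ) 1) :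
    (fun w => a * C w + (1 - a) * D w) ∈ copulasDP.{u} n := by
  have hb : 0 ≤ 1 - a := sub_nonneg.2 ha.2
  let π : Measure Bool :=
    ENNReal.ofReal a • Measure.dirac true + ENNReal.ofReal (1 - a) • Measure.dirac false
  have : IsProbabilityMeasure π := ⟨by simp [π, ← ENNReal.ofReal_add ha.1 hb]⟩
  have key := integral_mem_copulasDP hn π (C := fun t => bif t then C else D)
    (by rintro (_ | _); exacts [hD, hC]) fun w => measurable_of_countable _
  convert key using 2 with w
  have hi (t : Bool) : Integrable (fun t => (bif t then C else D) w) (Measure.dirac t) :=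
    integrable_dirac (by simp)
  rw [integral_add_measure ((hi _).smul_measure (by simp)) ((hi _).smul_measure (by simp)),
    integral_smul_measure, integral_smul_measure]
  simp [ENNReal.toReal_ofReal ha.1, ENNReal.toReal_ofReal hb]

/-! ### Comonotone, independent and weakly negatively associated copulas. -/

theorem comonotonicityCopula_mem_copulasDP {n : ℕ} (hn : 0 < n) :
    comonotonicityCopula n ∈ copulasDP.{u} n := by
  have : Nonempty (Fin n) := ⟨⟨0, hn⟩⟩
  have hd : Measurable fun (t : ℝ) (_ : Fin n) => t := measurable_pi_lambda _ fun _ => measurable_id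
  let μ : Measure (Fin n → ℝ) := uniformUnit.map fun t _ => t
  have : IsProbabilityMeasure μ := Measure.isProbabilityMeasure_map hd.aemeasurable
  have hμ : HasUniformMarginals μ := fun i => by
    rw [Measure.map_map (measurable_pi_apply i) hd]
    exact Measure.map_id
  have hcdf : comonotonicityCopula n = cubeCDF μ := by
    ext w
    have hs : MeasurableSet {x : Fin n → ℝ | ∀ i, x i ≤ (w i : ℝ)} := by
      simp only [Set.ofPred_forall]
      exact MeasurableSet.iInter fun i =>
        measurableSet_le (measurable_pi_apply i) measurable_const
    have hbdd : BddBelow (Set.range fun i => (w i : ℝ)) := ⟨0, by rintro _ ⟨i, rfl⟩; exact (w i).2.1⟩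
    have hpre : (fun (t : ℝ) (_ : Fin n) => t) ⁻¹' {x | ∀ i, x i ≤ (w i : ℝ)} =
        Set.Iic (⨅ i, (w i : ℝ)) := by
      ext t; exact (le_ciInf_iff hbdd).symm
    rw [cubeCDF, measureReal_def, Measure.map_apply hd hs, hpre,
      uniformUnit_Iic ((ciInf_le hbdd ⟨0, hn⟩).trans (w _).2.2),
      ENNReal.toReal_ofReal (le_ciInf fun i => (w i).2.1)]
    rfl
  rw [hcdf, cubeCDF_mem_copulasDP_iff hn hμ]
  intro θ hθ x
  rw [Measure.map_apply hd (measurableSet_sum_mul_toPareto_le θ x), ← map_toPareto_uniformUnit,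
    Measure.map_apply measurable_toPareto measurableSet_Iic]
  -- On the diagonal the weighted sum collapses to `toPareto t`, because the weights sum to `1`.
  refine measure_mono fun t ht => ?_
  have ht' : ∑ i, θ i * toPareto t ≤ x := ht
  rwa [← Finset.sum_mul, hθ.2, one_mul] at ht'

theorem independenceCopula_mem_copulasDP {n : ℕ} (hn : 0 < n) :
    independenceCopula n ∈ copulasDP.{u} n := by
  let μ : Measure (Fin n → ℝ) := Measure.pi fun _ => uniformUnit
  have hμ : HasUniformMarginals μ := fun i =>
    (measurePreserving_eval (fun _ : Fin n => uniformUnit) i).map_eq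
  have hcdf : independenceCopula n = cubeCDF μ := by
    ext w
    have hs : {x : Fin n → ℝ | ∀ i, x i ≤ (w i : ℝ)} = Set.univ.pi fun i => Set.Iic (w i : ℝ) := by
      ext x; simp [Pi.le_def]
    rw [cubeCDF, hs, measureReal_def, Measure.pi_pi, ENNReal.toReal_prod]
    refine Finset.prod_congr rfl fun i _ => ?_
    rw [uniformUnit_Iic (w i).2.2, ENNReal.toReal_ofReal (w i).2.1]
  rw [hcdf, cubeCDF_mem_copulasDP_iff hn hμ]
  exact .of_cubeCDF_le_prod hμ fun w => by rw [← hcdf]; rfl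

theorem IsWNACopula.mem_copulasDP {n : ℕ} (hn : 0 < n) {C : (Fin n → unitInterval) → ℝ}
    (hC : IsWNACopula C) : C ∈ copulasDP.{u} n := by
  obtain ⟨μ, _, hμ, hwna, rfl⟩ := hC
  rw [cubeCDF_mem_copulasDP_iff hn hμ]
  exact .of_cubeCDF_le_prod hμ (hwna.cubeCDF_le_prod hμ)

theorem mainTheorem8 (n : ℕ) (hn : 2 ≤ n) :
    -- closed under mixtures of two copulas
    (∀ C ∈ copulasDP.{u} n, ∀ D ∈ copulasDP.{u} n, ∀ a ∈ Set.Icc (0 : ℝ) 1,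
      (fun w => a * C w + (1 - a) * D w) ∈ copulasDP.{u} n) ∧
    -- closed under arbitrary mixtures
    (∀ (T : Type v) [MeasurableSpace T] (π : Measure T)
      [IsProbabilityMeasure π] (C : T → (Fin n → unitInterval) → ℝ),
      (∀ t, C t ∈ copulasDP.{u} n) → (∀ w, Measurable (fun t => C t w)) →
      (fun w => ∫ t, C t w ∂π) ∈ copulasDP.{u} n) ∧
    comonotonicityCopula n ∈ copulasDP.{u} n ∧
    independenceCopula n ∈ copulasDP.{u} n ∧
    (∀ C : (Fin n → unitInterval) → ℝ, IsWNACopula C → C ∈ copulasDP.{u} n) := by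
  have hn0 : 0 < n := by omega
  exact ⟨fun C hC D hD a ha => mix_mem_copulasDP hn0 hC hD ha,
    fun T _ π _ C hC hm => integral_mem_copulasDP hn0 π hC hm,
    comonotonicityCopula_mem_copulasDP hn0, independenceCopula_mem_copulasDP hn0,
    fun C hC => hC.mem_copulasDP hn0⟩
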